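/- Let $\mathbb D=\{z\in\mathbb C:|z|<1\}$, let $\mathcal D\subset\mathbb D$ be a closed continuum (a nonempty, compact, connected set), and let $p,m\ge 1$ be integers and $\bar R>0$. For $z,\mu\in\mathbb D$ put $[z,\mu]_{\mathrm h}=\left|\frac{z-\mu}{1-\bar\mu z}\right|$. The hyperbolic Chebyshev constant of $\mathcal D$ is $$\tau(\mathcal D)=\lim_{q\to\infty}\ \min_{\mu_1,\dots,\mu_q\in\mathcal D}\ \max_{z\in\mathcal D}\Big(\prod_{k=1}^q[z,\mu_k]_{\mathrm h}\Big)^{1/q},$$ and $\eta_{q1},\dots,\eta_{qq}\in\mathcal D$ are called $q$-th Tsuji points of $\mathcal D$ if they maximize $\prod_{1\le k<l\le q}[z_k,z_l]_{\mathrm h}$ over all $z_1,\dots,z_q\in\mathcal D$. Let $\|G\|_2=\big(\frac1{2\pi}\int_0^{2\pi}\|G(e^{i\omega})\|_F^2\,d\omega\big)^{1/2}$ be the $\mathcal H_2$ norm, where $\|\cdot\|_F$ is the Frobenius norm, and let $\mathscr G$ be the set of all $p\times m$ transfer functions $G(z)=\sum_{j=1}^n\frac{R_j}{z-\lambda_j}$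 with $n$ arbitrary, distinct poles $\lambda_j\in\mathcal D$, and $R_j\in\mathbb C^{p\times m}$ with $\sum_{j=1}^n\|R_j\|_F\le\bar R$. For $\mu_1,\dots,\mu_q\in\mathbb D$ let $$E_q(\mu_1,\dots,\mu_q)=\max_{G\in\mathscr G}\ \min_{\check R_1,\dots,\check R_q\in\mathbb C^{p\times m}}\Big\|G-\sum_{k=1}^q\frac{\check R_k}{z-\mu_k}\Big\|_2 .$$ Theorem (Fundamental limit on the worst-case approximation bias). The limit defining $\tau(\mathcal D)$ exists, and the maximum and the minima in the definition of $E_q$ are attained. For any choice, for every $q$, of poles $\mu_{q1},\dots,\mu_{qq}\in\mathbb D$, $$\liminf_{q\to\infty}E_q(\mu_{q1},\dots,\mu_{qq})^{1/q}\ \ge\ \tau(\mathcal D).$$ If, for every $q$, $\eta_{q1},\dots,\eta_{qq}$ are $q$-th Tsuji points of $\mathcal D$, then $$\lim_{q\to\infty}E_q(\eta_{q1},\dots,\eta_{qq})^{1/q}=\tau(\mathcal D).$$ -/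

import Mathlib

open Filter Topology

namespace OBF

/-- The pseudohyperbolic distance `[z, μ]_h = |(z - μ) / (1 - conj μ * z)|` on the unit disk. -/
noncomputable def pseudoHyp (z μ : ℂ) : ℝ :=
  ‖(z - μ) / (1 - (starRingEnd ℂ) μ * z)‖

/-- The finite hyperbolic Chebyshev constant
`min_{μ₁,…,μ_q ∈ D} max_{z ∈ D} (∏ₖ [z, μₖ]_h)^(1/q)`. For nonempty compact `D` in the open
unit disk the extrema exist, so they coincide with the infimum and supremum used here. -/
noncomputable def finiteChebyshev (D : Set ℂ) (q : ℕ) : ℝ :=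
  ⨅ μ : Fin q → D, ⨆ z : D, (∏ k, pseudoHyp z (μ k)) ^ (1 / (q : ℝ))

/-- The hyperbolic Chebyshev constant `τ(D)`, the limit of the finite constants. -/
noncomputable def chebyshev (D : Set ℂ) : ℝ :=
  limUnder atTop (finiteChebyshev D)

/-- `η₁, …, η_q` are `q`-th Tsuji points of `D`: they lie in `D` and maximize the product of the
pairwise pseudohyperbolic distances among all `q`-tuples of points of `D`. -/
def IsTsuji (D : Set ℂ) {q : ℕ} (η : Fin q → ℂ) : Prop :=
  (∀ k, η k ∈ D) ∧
    ∀ w : Fin q → ℂ, (∀ k, w k ∈ D) →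
      ∏ j, ∏ k ∈ Finset.Ioi j, pseudoHyp (w j) (w k) ≤
        ∏ j, ∏ k ∈ Finset.Ioi j, pseudoHyp (η j) (η k)

/-- The transfer function `z ↦ ∑ⱼ Rⱼ / (z - aⱼ)`. -/
noncomputable def partialFraction {p m n : ℕ} (a : Fin n → ℂ)
    (R : Fin n → Matrix (Fin p) (Fin m) ℂ) (z : ℂ) : Matrix (Fin p) (Fin m) ℂ :=
  ∑ j, (z - a j)⁻¹ • R j

section Frobenius

-- matrix norms in this section are Frobenius norms
open scoped Matrix.Norms.Frobenius

/-- The `H₂` norm `((1/2π) ∫ ‖G(e^{iω})‖_F² dω)^(1/2)` of a transfer function without poles on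
the unit circle. -/
noncomputable def h2Norm {p m : ℕ} (G : ℂ → Matrix (Fin p) (Fin m) ℂ) : ℝ :=
  Real.sqrt (Real.circleAverage (fun z => ‖G z‖ ^ 2) 0 1)

/-- The `p × m` systems `G(z) = ∑ⱼ Rⱼ / (z - λⱼ)`, with any finite number of distinct poles
`λⱼ ∈ D` and `∑ⱼ ‖Rⱼ‖_F ≤ Rbar`. -/
def systemClass (p m : ℕ) (D : Set ℂ) (Rbar : ℝ) : Set (ℂ → Matrix (Fin p) (Fin m) ℂ) :=
  {G | ∃ (n : ℕ) (lam : Fin n → ℂ) (R : Fin n → Matrix (Fin p) (Fin m) ℂ),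
    Function.Injective lam ∧ (∀ j, lam j ∈ D) ∧ ∑ j, ‖R j‖ ≤ Rbar ∧ G = partialFraction lam R}

end Frobenius

/-- The optimal `H₂` error of approximating `G` by `∑ₖ Řₖ / (z - μₖ)` over all coefficient
matrices `Řₖ`. -/
noncomputable def optimalError {p m q : ℕ} (μ : Fin q → ℂ)
    (G : ℂ → Matrix (Fin p) (Fin m) ℂ) : ℝ :=
  ⨅ R : Fin q → Matrix (Fin p) (Fin m) ℂ, h2Norm (G - partialFraction μ R)

/-- The worst case of the optimal `H₂` error over the class of systems. -/
noncomputable def worstCaseError (p m : ℕ) (D : Set ℂ) (Rbar : ℝ) {q : ℕ} (μ : Fin q → ℂ) : ℝ :=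
  ⨆ G : systemClass p m D Rbar, optimalError μ (G : ℂ → Matrix (Fin p) (Fin m) ℂ)

end OBF

/-! Expanding 1/(z - a) = ∑ aⁿ z^(-n-1) turns the H₂ inner product into the ℓ² inner product of
Szegő kernels. The best approximation with poles μ_k is therefore the orthogonal projection onto the
span of the kernels at the μ_k. The distance of the kernel at a from that span is d(a; μ) = (1 -
|a|²)^(-1/2) ∏ [a, μ]_h over the distinct μ (`exists_residual_norm`). By the triangle inequality a
single pole is the worst case, so E_q is `Rbar` times the maximum of d(a; μ) over a ∈ D
(`exists_isGreatest_optimalError`). The weight (1 - |a|²)^(-1/2) is bounded on the compact set D and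
disappears under q-th roots.

It remains to compare these maxima with M_q = `minMax D q`. The engine is a dimension count
(`one_le_sum_resNorm_div`): some nonzero combination of q + 1 kernels at points z_i is orthogonal to
the q kernels at the x_k, which forces ∑ᵢ d(z_i; x) / d(z_i; z_j, j ≠ i) ≥ 1. For z the (q + 1)-th
Tsuji points, every denominator is at least M_q, so max d(·; μ) ≥ M_q / (q + 1) for all μ. For z a
point a ∈ D together with the q-th Tsuji points η, the weight-free denominators are at least ∏ [a,
η_k]_h, so this product is at most (q + 1) M_q.

Finally M_q is submultiplicative, so M_q^(1/q) converges by Fekete's lemma, and (q + 1)^(1/q) → 1. A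
one-point D is separate: there M_q = 0 for q ≥ 1. -/

namespace OBF

/-! ### Szegő kernels and their residuals -/

/-- The Szegő kernel functions `(aⁿ)ₙ` of the unit disk, as elements of `ℓ²`. -/
noncomputable def szego (a : ℂ) : lp (fun _ : ℕ => ℂ) 2 :=
  open Classical in if h : Memℓp (fun n : ℕ => a ^ n) 2 then ⟨_, h⟩ else 0

theorem szego_apply {a : ℂ} (ha : ‖a‖ < 1) (n : ℕ) : szego a n = a ^ n := by
  have h : Memℓp (fun n : ℕ => a ^ n) 2 := by
    refine memℓp_gen ?_
    have : Summable fun n : ℕ => (‖a‖ ^ 2) ^ n :=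
      summable_geometric_of_lt_one (by positivity) (by nlinarith [norm_nonneg a])
    refine this.congr fun n => ?_
    simp [← pow_mul, mul_comm]
  rw [szego, dif_pos h]

theorem norm_conj_mul_lt {a b : ℂ} (ha : ‖a‖ < 1) (hb : ‖b‖ < 1) :
    ‖(starRingEnd ℂ) a * b‖ < 1 := by
  rw [norm_mul, RCLike.norm_conj]
  nlinarith [norm_nonneg a, norm_nonneg b]

theorem one_sub_conj_mul_ne_zero {a b : ℂ} (ha : ‖a‖ < 1) (hb : ‖b‖ < 1) :
    1 - (starRingEnd ℂ) a * b ≠ 0 := by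
  intro h
  have := norm_conj_mul_lt ha hb
  rw [← sub_eq_zero.mp h] at this
  simp at this

theorem inner_szego {a b : ℂ} (ha : ‖a‖ < 1) (hb : ‖b‖ < 1) :
    inner ℂ (szego a) (szego b) = (1 - (starRingEnd ℂ) a * b)⁻¹ := by
  rw [lp.inner_eq_tsum, ← tsum_geometric_of_norm_lt_one (norm_conj_mul_lt ha hb)]
  refine tsum_congr fun n => ?_
  rw [szego_apply ha, szego_apply hb, RCLike.inner_apply, map_pow, mul_pow, mul_comm]

/-- The Blaschke product with zero set `S`. -/
noncomputable def blaschke (S : Finset ℂ) (a : ℂ) : ℂ :=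
  ∏ μ ∈ S, (a - μ) / (1 - (starRingEnd ℂ) μ * a)

theorem blaschke_ne_zero {S : Finset ℂ} (hS : ∀ μ ∈ S, ‖μ‖ < 1) {a : ℂ} (ha : ‖a‖ < 1)
    (haS : a ∉ S) : blaschke S a ≠ 0 := by
  refine Finset.prod_ne_zero_iff.mpr fun μ hμ => div_ne_zero ?_ ?_
  · exact sub_ne_zero.mpr fun h => haS (h ▸ hμ)
  · exact one_sub_conj_mul_ne_zero (hS μ hμ) ha

theorem inner_eq_zero_of_mem_span {S : Set ℂ} {v : lp (fun _ : ℕ => ℂ) 2}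
    (h : ∀ μ ∈ S, inner ℂ (szego μ) v = 0) {x : lp (fun _ : ℕ => ℂ) 2}
    (hx : x ∈ Submodule.span ℂ (szego '' S)) : inner ℂ x v = 0 := by
  induction hx using Submodule.span_induction with
  | mem x hx => obtain ⟨μ, hμ, rfl⟩ := hx; exact h μ hμ
  | zero => simp
  | add x y _ _ hx hy => rw [inner_add_left, hx, hy, add_zero]
  | smul c x _ hx => rw [inner_smul_left, hx, mul_zero]

/-- The components of the kernel functions orthogonal to finitely many kernel functions. -/
theorem exists_residual (S : Finset ℂ) (hS : ∀ μ ∈ S, ‖μ‖ < 1) :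
    ∃ r : ℂ → lp (fun _ : ℕ => ℂ) 2,
      (∀ a, szego a - r a ∈ Submodule.span ℂ (szego '' S)) ∧
      (∀ a, ‖a‖ < 1 → ∀ μ ∈ S, inner ℂ (szego μ) (r a) = 0) ∧
      ∀ a b, ‖a‖ < 1 → ‖b‖ < 1 → inner ℂ (r a) (r b) =
        (starRingEnd ℂ) (blaschke S a) * blaschke S b / (1 - (starRingEnd ℂ) a * b) := by
  classical
  induction S using Finset.induction_on with
  | empty =>
    exact ⟨szego, by simp, by simp, fun a b ha hb => by simp [blaschke, inner_szego ha hb]⟩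
  | insert μ S hμS ih =>
    obtain ⟨r, h1, h2, h3⟩ := ih fun ν hν => hS ν (Finset.mem_insert_of_mem hν)
    have hμ : ‖μ‖ < 1 := hS μ (Finset.mem_insert_self _ _)
    have hB := blaschke_ne_zero (fun ν hν => hS ν (Finset.mem_insert_of_mem hν)) hμ hμS
    have hμμ := one_sub_conj_mul_ne_zero hμ hμ
    -- Since `μ ∉ S`, the Blaschke product does not vanish at `μ`, so one more Gram–Schmidt step is
    -- possible.
    have hK : inner ℂ (r μ) (r μ) ≠ 0 := by
      rw [h3 μ μ hμ hμ]
      exact div_ne_zero (mul_ne_zero (by simpa using hB) hB) hμμ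
    have hmono : Submodule.span ℂ (szego '' (S : Set ℂ)) ≤
        Submodule.span ℂ (szego '' (insert μ S : Finset ℂ)) :=
      Submodule.span_mono (Set.image_mono (by simp))
    have hsz : szego μ ∈ Submodule.span ℂ (szego '' (insert μ S : Finset ℂ)) :=
      Submodule.subset_span ⟨μ, by simp, rfl⟩
    have hin : ∀ a b, ‖b‖ < 1 → inner ℂ (szego a) (r b) = inner ℂ (r a) (r b) := fun a b hb => by
      have := inner_eq_zero_of_mem_span (h2 b hb) (h1 a)
      rwa [inner_sub_left, sub_eq_zero] at this
    set c : ℂ → ℂ := fun a => inner ℂ (r μ) (r a) / inner ℂ (r μ) (r μ) with hc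
    have horth : ∀ a, inner ℂ (r μ) (r a - c a • r μ) = 0 := fun a => by
      rw [inner_sub_right, inner_smul_right, hc, div_mul_cancel₀ _ hK, sub_self]
    refine ⟨fun a => r a - c a • r μ, fun a => ?_, fun a ha ν hν => ?_, fun a b ha hb => ?_⟩
    · have : szego a - (r a - c a • r μ) =
          (szego a - r a) + c a • (szego μ - (szego μ - r μ)) := by
        rw [sub_sub_cancel]; abel
      rw [this]
      exact add_mem (hmono (h1 a)) (Submodule.smul_mem _ _ (sub_mem hsz (hmono (h1 μ))))
    · rcases Finset.mem_insert.mp hν with rfl | hν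
      · rw [inner_sub_right, inner_smul_right, hin _ _ ha, hin _ _ hμ, ← inner_smul_right,
          ← inner_sub_right, horth]
      · rw [inner_sub_right, inner_smul_right, h2 a ha ν hν, h2 μ hμ ν hν, mul_zero, sub_zero]
    · rw [inner_sub_left, inner_smul_left, horth, mul_zero, sub_zero, inner_sub_right,
        inner_smul_right, hc]
      have hins : ∀ a, blaschke (insert μ S) a =
          (a - μ) / (1 - (starRingEnd ℂ) μ * a) * blaschke S a := fun a =>
        Finset.prod_insert hμS
      simp only [hins, h3 _ _ hμ hb, h3 _ _ ha hμ, h3 _ _ hμ hμ, h3 _ _ ha hb, map_mul,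
        map_div₀, map_sub, map_one, Complex.conj_conj]
      have e1 := one_sub_conj_mul_ne_zero ha hb
      have e2 := one_sub_conj_mul_ne_zero ha hμ
      have e3 := one_sub_conj_mul_ne_zero hμ hb
      have e4 : 1 - b * (starRingEnd ℂ) a ≠ 0 := by rwa [mul_comm]
      have e5 : 1 - μ * (starRingEnd ℂ) a ≠ 0 := by rwa [mul_comm]
      have e6 : 1 - b * (starRingEnd ℂ) μ ≠ 0 := by rwa [mul_comm]
      have e7 : 1 - μ * (starRingEnd ℂ) μ ≠ 0 := by rwa [mul_comm]
      have e8 : (starRingEnd ℂ) (blaschke S μ) ≠ 0 := by simpa using hB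
      -- After removing the common Blaschke factors, this is 1/(1 - āb) - (1 - |μ|²)/((1 - āμ)(1 -
      -- μ̄b)) = (ā - μ̄)(b - μ)/((1 - āb)(1 - āμ)(1 - μ̄b)).
      field_simp
      ring

/-- The norm of the component of `szego a` orthogonal to the kernel functions of `S`. -/
noncomputable def resNorm (S : Finset ℂ) (a : ℂ) : ℝ :=
  (Real.sqrt (1 - ‖a‖ ^ 2))⁻¹ * ∏ μ ∈ S, pseudoHyp a μ

theorem one_sub_norm_sq_pos {a : ℂ} (ha : ‖a‖ < 1) : 0 < 1 - ‖a‖ ^ 2 := by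
  nlinarith [norm_nonneg a]

theorem exists_residual_norm (S : Finset ℂ) (hS : ∀ μ ∈ S, ‖μ‖ < 1) :
    ∃ r : ℂ → lp (fun _ : ℕ => ℂ) 2,
      (∀ a, szego a - r a ∈ Submodule.span ℂ (szego '' S)) ∧
      (∀ a, ‖a‖ < 1 → ∀ μ ∈ S, inner ℂ (szego μ) (r a) = 0) ∧
      ∀ a, ‖a‖ < 1 → ‖r a‖ = resNorm S a := by
  obtain ⟨r, h1, h2, h3⟩ := exists_residual S hS
  refine ⟨r, h1, h2, fun a ha => ?_⟩
  have h := h3 a a ha ha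
  have hpos := one_sub_norm_sq_pos ha
  rw [inner_self_eq_norm_sq_to_K, Complex.conj_mul', Complex.conj_mul'] at h
  have h' : ‖r a‖ ^ 2 = ‖blaschke S a‖ ^ 2 / (1 - ‖a‖ ^ 2) := by
    apply Complex.ofReal_injective
    push_cast
    exact h
  have hb : ‖blaschke S a‖ = ∏ μ ∈ S, pseudoHyp a μ := by
    simp [blaschke, pseudoHyp, norm_prod]
  rw [← Real.sqrt_sq (norm_nonneg (r a)), h', Real.sqrt_div (by positivity),
    Real.sqrt_sq (norm_nonneg _), hb, resNorm, div_eq_inv_mul]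

theorem pseudoHyp_nonneg (z μ : ℂ) : 0 ≤ pseudoHyp z μ := norm_nonneg _

theorem pseudoHyp_pos {z μ : ℂ} (hz : ‖z‖ < 1) (hμ : ‖μ‖ < 1) (h : z ≠ μ) :
    0 < pseudoHyp z μ :=
  norm_pos_iff.mpr (div_ne_zero (sub_ne_zero.mpr h) (one_sub_conj_mul_ne_zero hμ hz))

theorem resNorm_nonneg (S : Finset ℂ) (a : ℂ) : 0 ≤ resNorm S a :=
  mul_nonneg (by positivity) (Finset.prod_nonneg fun _ _ => pseudoHyp_nonneg _ _)

theorem resNorm_pos {S : Finset ℂ} (hS : ∀ μ ∈ S, ‖μ‖ < 1) {a : ℂ} (ha : ‖a‖ < 1)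
    (haS : a ∉ S) : 0 < resNorm S a :=
  mul_pos (inv_pos.mpr (Real.sqrt_pos.mpr (one_sub_norm_sq_pos ha)))
    (Finset.prod_pos fun μ hμ => pseudoHyp_pos ha (hS μ hμ) fun h => haS (h ▸ hμ))

/-! ### The dimension-count inequality -/

/-- Among `q + 1` independent kernel functions, some are at a definite distance from the span of
any `q` kernel functions. -/
theorem one_le_sum_resNorm_div {q : ℕ} {z : Fin (q + 1) → ℂ} (hz : ∀ i, ‖z i‖ < 1)
    (hinj : Function.Injective z) {x : Fin q → ℂ} (hx : ∀ k, ‖x k‖ < 1) :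
    1 ≤ ∑ i, resNorm (Finset.univ.image x) (z i) /
      resNorm (Finset.univ.image (z ∘ i.succAbove)) (z i) := by
  obtain ⟨r, h1, h2, h3⟩ := exists_residual_norm (Finset.univ.image x) (by simpa using hx)
  -- The kernel of `f` consists of the coefficients of combinations orthogonal to every `szego (x
  -- k)`; it is nonzero because q < q + 1.
  let f : (Fin (q + 1) → ℂ) →ₗ[ℂ] (Fin q → ℂ) :=
    LinearMap.pi fun k => ∑ i, (inner ℂ (szego (x k)) (szego (z i))) • LinearMap.proj i
  obtain ⟨c, hc, hc0⟩ := Submodule.exists_mem_ne_zero_of_ne_bot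
    (LinearMap.ker_ne_bot_of_finrank_lt (f := f) (by simp))
  set u := ∑ i, c i • szego (z i) with hu
  have hux : ∀ k, inner ℂ (szego (x k)) u = 0 := fun k => by
    have := congrFun (LinearMap.mem_ker.mp hc) k
    simp only [f, LinearMap.pi_apply, LinearMap.sum_apply, LinearMap.smul_apply,
      LinearMap.proj_apply, smul_eq_mul, Pi.zero_apply] at this
    rw [hu, inner_sum, ← this]
    exact Finset.sum_congr rfl fun i _ => by rw [inner_smul_right, mul_comm]
  have hcoef : ∀ i, ‖c i‖ ≤ ‖u‖ / resNorm (Finset.univ.image (z ∘ i.succAbove)) (z i) ∧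
      0 < resNorm (Finset.univ.image (z ∘ i.succAbove)) (z i) := fun i => by
    have hS : ∀ μ ∈ Finset.univ.image (z ∘ i.succAbove), ‖μ‖ < 1 := by
      simpa using fun j => hz _
    have hpos := resNorm_pos hS (hz i) (by
      simpa using fun j h => Fin.succAbove_ne i j (hinj h))
    refine ⟨?_, hpos⟩
    obtain ⟨ρ, g1, g2, g3⟩ := exists_residual_norm _ hS
    have hself : inner ℂ (szego (z i)) (ρ (z i)) = (‖ρ (z i)‖ : ℂ) ^ 2 := by
      have := inner_eq_zero_of_mem_span (g2 (z i) (hz i)) (g1 (z i))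
      rw [inner_sub_left, sub_eq_zero] at this
      rw [this]; exact inner_self_eq_norm_sq_to_K _
    -- Pairing with the residual against the other q kernels isolates the coefficient `c i`;
    -- Cauchy–Schwarz then bounds it.
    have hsum : inner ℂ u (ρ (z i)) = (starRingEnd ℂ) (c i) * (‖ρ (z i)‖ : ℂ) ^ 2 := by
      rw [hu, sum_inner, Fin.sum_univ_succAbove _ i, Finset.sum_eq_zero, add_zero,
        inner_smul_left, hself]
      intro j _
      rw [inner_smul_left, g2 (z i) (hz i) _ (by simp), mul_zero]
    have hle := norm_inner_le_norm (𝕜 := ℂ) u (ρ (z i))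
    rw [hsum, norm_mul, RCLike.norm_conj, norm_pow, Complex.norm_real, norm_norm, g3 _ (hz i)]
      at hle
    rw [le_div_iff₀ hpos]
    nlinarith
  have hunorm : 0 < ‖u‖ := by
    obtain ⟨i, hi⟩ := Function.ne_iff.mp hc0
    obtain ⟨h, hp⟩ := hcoef i
    have : 0 < ‖u‖ / _ := (norm_pos_iff.mpr hi).trans_le h
    exact (div_pos_iff_of_pos_right hp).mp this
  have hle : ‖u‖ ^ 2 ≤ ∑ i, ‖c i‖ * (‖u‖ * resNorm (Finset.univ.image x) (z i)) := by
    have hsq : inner ℂ u u = (‖u‖ : ℂ) ^ 2 := inner_self_eq_norm_sq_to_K u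
    -- As `u` is orthogonal to the kernels at the `x k`, each `szego (z i)` may be replaced by its
    -- residual when paired with `u`.
    have hexp : inner ℂ u u = ∑ i, c i * inner ℂ u (r (z i)) := by
      conv_lhs => rw [hu]
      rw [← hu, inner_sum]
      refine Finset.sum_congr rfl fun i _ => ?_
      rw [inner_smul_right]
      have := inner_eq_zero_of_mem_span (v := u) (by simpa using hux) (h1 (z i))
      rw [inner_eq_zero_symm, inner_sub_right, sub_eq_zero] at this
      rw [this]
    have : ‖u‖ ^ 2 = ‖inner ℂ u u‖ := by rw [hsq]; simp
    rw [this, hexp]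
    refine (norm_sum_le _ _).trans (Finset.sum_le_sum fun i _ => ?_)
    rw [norm_mul, ← h3 _ (hz i)]
    gcongr
    exact norm_inner_le_norm _ _
  have hle2 : ‖u‖ ^ 2 ≤ ‖u‖ ^ 2 * ∑ i, resNorm (Finset.univ.image x) (z i) /
      resNorm (Finset.univ.image (z ∘ i.succAbove)) (z i) := by
    refine hle.trans ?_
    rw [Finset.mul_sum]
    refine Finset.sum_le_sum fun i _ => ?_
    refine (mul_le_mul_of_nonneg_right (hcoef i).1
      (mul_nonneg hunorm.le (resNorm_nonneg _ _))).trans (le_of_eq ?_)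
    ring
  exact (le_mul_iff_one_le_right (by positivity)).mp hle2

/-! ### The H₂ norm as an ℓ² norm -/

/-- On the unit circle conj z = 1/z, so the conjugate factor is z/(1 - b̄z), and Cauchy's integral
formula at `a` applies. -/
theorem circleAverage_inv_sub_mul_conj {a b : ℂ} (ha : ‖a‖ < 1) (hb : ‖b‖ < 1) :
    Real.circleAverage (fun z => (z - a)⁻¹ * (starRingEnd ℂ) ((z - b)⁻¹)) 0 1 =
      (1 - (starRingEnd ℂ) b * a)⁻¹ := by
  have hd : DifferentiableOn ℂ (fun z => (1 - (starRingEnd ℂ) b * z)⁻¹)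
      (closure (Metric.ball 0 1)) := by
    intro z hz
    rw [closure_ball _ one_ne_zero, mem_closedBall_zero_iff] at hz
    refine DifferentiableAt.differentiableWithinAt (DifferentiableAt.inv (by fun_prop) ?_)
    intro h
    have h1 : ‖(starRingEnd ℂ) b * z‖ = 1 := by rw [← sub_eq_zero.mp h, norm_one]
    rw [norm_mul, RCLike.norm_conj] at h1
    nlinarith [norm_nonneg b, norm_nonneg z]
  rw [Real.circleAverage_eq_circleIntegral one_ne_zero,
    ← hd.diffContOnCl.two_pi_i_inv_smul_circleIntegral_sub_inv_smul
      (w := a) (by simpa using ha)]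
  congr 1
  refine circleIntegral.integral_congr zero_le_one fun z hz => ?_
  have hz1 : ‖z‖ = 1 := by simpa using hz
  have hz0 : z ≠ 0 := by rintro rfl; simp at hz1
  have hconj : (starRingEnd ℂ) z = z⁻¹ := by
    rw [Complex.inv_def, Complex.normSq_eq_norm_sq, hz1]; simp
  have hne : 1 - (starRingEnd ℂ) b * z ≠ 0 := by
    intro h
    have h1 : ‖(starRingEnd ℂ) b * z‖ = 1 := by rw [← sub_eq_zero.mp h, norm_one]
    rw [norm_mul, RCLike.norm_conj, hz1] at h1
    linarith
  have : z⁻¹ - (starRingEnd ℂ) b = (1 - (starRingEnd ℂ) b * z) * z⁻¹ := by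
    field_simp
  simp only [sub_zero, smul_eq_mul, map_inv₀, map_sub, hconj, this, mul_inv, inv_inv]
  field_simp

theorem sub_ne_zero_of_mem_sphere {a z : ℂ} (ha : ‖a‖ < 1) (hz : z ∈ Metric.sphere (0 : ℂ) |1|) :
    z - a ≠ 0 := by
  rintro h
  rw [sub_eq_zero.mp h] at hz
  simp at hz
  linarith

theorem circleAverage_normSq_sum {ι : Type*} [Fintype ι] (a c : ι → ℂ) (ha : ∀ i, ‖a i‖ < 1) :
    Real.circleAverage (fun z => ‖∑ i, (z - a i)⁻¹ * c i‖ ^ 2) 0 1 =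
      ‖∑ i, c i • szego (a i)‖ ^ 2 := by
  have hcont : ∀ i, ContinuousOn (fun z => (z - a i)⁻¹) (Metric.sphere 0 |1|) := fun i =>
    ContinuousOn.inv₀ (by fun_prop) fun z hz => sub_ne_zero_of_mem_sphere (ha i) hz
  have hint : ∀ i j, CircleIntegrable (fun z => (c i * (starRingEnd ℂ) (c j)) •
      ((z - a i)⁻¹ * (starRingEnd ℂ) ((z - a j)⁻¹))) 0 1 := fun i j =>
    ContinuousOn.circleIntegrable' (continuousOn_const.mul ((hcont i).mul
      (Complex.continuous_conj.comp_continuousOn (hcont j))) :)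
  apply Complex.ofReal_injective
  have h := Complex.ofRealCLM.circleAverage_comp_comm (c := 0) (R := 1)
    (f := fun z => ‖∑ i, (z - a i)⁻¹ * c i‖ ^ 2)
    (ContinuousOn.circleIntegrable' (((continuousOn_finsetSum _ fun i _ =>
      (hcont i).mul continuousOn_const).norm).pow 2))
  rw [Complex.ofRealCLM_apply] at h
  rw [← h]
  have hexp : (Complex.ofRealCLM ∘ fun z => ‖∑ i, (z - a i)⁻¹ * c i‖ ^ 2) = fun z =>
      ∑ i, ∑ j, (c i * (starRingEnd ℂ) (c j)) •
        ((z - a i)⁻¹ * (starRingEnd ℂ) ((z - a j)⁻¹)) := by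
    funext z
    simp only [Function.comp_apply, Complex.ofRealCLM_apply]
    push_cast
    rw [← Complex.mul_conj', map_sum, Finset.sum_mul_sum]
    refine Finset.sum_congr rfl fun i _ => Finset.sum_congr rfl fun j _ => ?_
    simp only [map_mul, smul_eq_mul]
    ring
  rw [hexp, Real.circleAverage_fun_sum fun i _ => ?_]
  · have hin : ((‖∑ i, c i • szego (a i)‖ ^ 2 : ℝ) : ℂ) =
        inner ℂ (∑ i, c i • szego (a i)) (∑ i, c i • szego (a i)) := by
      rw [inner_self_eq_norm_sq_to_K]; exact Complex.ofReal_pow _ _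
    rw [hin, sum_inner, Finset.sum_congr rfl fun i _ => inner_sum _ _ _, Finset.sum_comm]
    refine Finset.sum_congr rfl fun i _ => ?_
    rw [Real.circleAverage_fun_sum fun j _ => hint i j]
    refine Finset.sum_congr rfl fun j _ => ?_
    rw [Real.circleAverage_fun_smul, circleAverage_inv_sub_mul_conj (ha i) (ha j),
      inner_smul_left, inner_smul_right, inner_szego (ha j) (ha i), smul_eq_mul]
    ring
  · exact CircleIntegrable.fun_sum _ fun j _ => hint i j

section Frobenius

open scoped Matrix.Norms.Frobenius

theorem frobenius_norm_sq {p m : ℕ} (A : Matrix (Fin p) (Fin m) ℂ) :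
    ‖A‖ ^ 2 = ∑ s, ∑ t, ‖A s t‖ ^ 2 := by
  rw [Matrix.frobenius_norm_def, ← Real.sqrt_eq_rpow, Real.sq_sqrt (by positivity)]
  simp

theorem h2Norm_sum {ι : Type*} [Fintype ι] {p m : ℕ} (a : ι → ℂ) (ha : ∀ i, ‖a i‖ < 1)
    (R : ι → Matrix (Fin p) (Fin m) ℂ) :
    h2Norm (fun z => ∑ i, (z - a i)⁻¹ • R i) =
      Real.sqrt (∑ s, ∑ t, ‖∑ i, R i s t • szego (a i)‖ ^ 2) := by
  have hint : ∀ s t, CircleIntegrable (fun z => ‖∑ i, (z - a i)⁻¹ * R i s t‖ ^ 2) 0 1 :=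
    fun s t => ContinuousOn.circleIntegrable' (((continuousOn_finsetSum _ fun i _ =>
      (ContinuousOn.inv₀ (by fun_prop) fun z hz =>
        sub_ne_zero_of_mem_sphere (ha i) hz).mul continuousOn_const).norm).pow 2)
  rw [h2Norm]
  congr 1
  have : (fun z => ‖∑ i, (z - a i)⁻¹ • R i‖ ^ 2) =
      fun z => ∑ s, ∑ t, ‖∑ i, (z - a i)⁻¹ * R i s t‖ ^ 2 := by
    funext z
    rw [frobenius_norm_sq]
    simp [Matrix.sum_apply]
  rw [this, Real.circleAverage_fun_sum fun s _ => CircleIntegrable.fun_sum _ fun t _ => hint s t]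
  refine Finset.sum_congr rfl fun s _ => ?_
  rw [Real.circleAverage_fun_sum fun t _ => hint s t]
  exact Finset.sum_congr rfl fun t _ => circleAverage_normSq_sum _ _ ha

theorem h2Norm_partialFraction_sub {p m n q : ℕ} {a : Fin n → ℂ} (ha : ∀ i, ‖a i‖ < 1)
    {μ : Fin q → ℂ} (hμ : ∀ k, ‖μ k‖ < 1) (R : Fin n → Matrix (Fin p) (Fin m) ℂ)
    (R' : Fin q → Matrix (Fin p) (Fin m) ℂ) :
    h2Norm (partialFraction a R - partialFraction μ R') =
      Real.sqrt (∑ s, ∑ t,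
        ‖∑ i, R i s t • szego (a i) - ∑ k, R' k s t • szego (μ k)‖ ^ 2) := by
  have h := h2Norm_sum (Sum.elim a μ) (by rintro (i | i) <;> simp [ha, hμ])
    (Sum.elim R fun k => -R' k)
  simp only [Fintype.sum_sum_type, Sum.elim_inl, Sum.elim_inr, smul_neg, Finset.sum_neg_distrib,
    Matrix.neg_apply, neg_smul, ← sub_eq_add_neg] at h
  exact h

/-- This is the triangle inequality in the ℓ² sum of p·m copies of `E`, where the block (R j) ⊗ (v
j) has norm `‖R j‖ * ‖v j‖`. -/
theorem sqrt_sum_norm_sq_le {E : Type*} [NormedAddCommGroup E] [NormedSpace ℂ E] {p m n : ℕ}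
    (R : Fin n → Matrix (Fin p) (Fin m) ℂ) (v : Fin n → E) :
    Real.sqrt (∑ s, ∑ t, ‖∑ j, R j s t • v j‖ ^ 2) ≤ ∑ j, ‖R j‖ * ‖v j‖ := by
  let x : Fin n → PiLp 2 (fun _ : Fin p × Fin m => E) := fun j =>
    WithLp.toLp 2 fun st => R j st.1 st.2 • v j
  have hx : ∀ j, ‖x j‖ = ‖R j‖ * ‖v j‖ := fun j => by
    rw [PiLp.norm_eq_of_L2, ← Real.sqrt_sq (mul_nonneg (norm_nonneg (R j)) (norm_nonneg (v j))),
      mul_pow, frobenius_norm_sq, Fintype.sum_prod_type]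
    simp [x, norm_smul, mul_pow, Finset.sum_mul]
  have hsum : Real.sqrt (∑ s, ∑ t, ‖∑ j, R j s t • v j‖ ^ 2) = ‖∑ j, x j‖ := by
    rw [PiLp.norm_eq_of_L2, Fintype.sum_prod_type]
    simp [x]
  rw [hsum]
  exact (norm_sum_le _ _).trans_eq (Finset.sum_congr rfl fun j _ => hx j)

/-! ### Optimal and worst-case errors -/

/-- The minimal `H₂` error is attained by projecting the kernel functions. -/
theorem isLeast_optimalError {p m n q : ℕ} {a : Fin n → ℂ} (ha : ∀ i, ‖a i‖ < 1)
    {μ : Fin q → ℂ} (hμ : ∀ k, ‖μ k‖ < 1) (R : Fin n → Matrix (Fin p) (Fin m) ℂ)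
    {r : ℂ → lp (fun _ : ℕ => ℂ) 2}
    (h1 : ∀ a, szego a - r a ∈ Submodule.span ℂ (szego '' (Finset.univ.image μ : Finset ℂ)))
    (h2 : ∀ a, ‖a‖ < 1 → ∀ ν ∈ Finset.univ.image μ, inner ℂ (szego ν) (r a) = 0) :
    IsLeast (Set.range fun R' : Fin q → Matrix (Fin p) (Fin m) ℂ =>
        h2Norm (partialFraction a R - partialFraction μ R'))
      (Real.sqrt (∑ s, ∑ t, ‖∑ j, R j s t • r (a j)‖ ^ 2)) := by
  have hc : ∀ a, ∃ c : Fin q → ℂ, ∑ k, c k • szego (μ k) = szego a - r a := fun a => by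
    rw [← Submodule.mem_span_range_iff_exists_fun]
    convert h1 a using 2
    ext x; simp
  choose c hc using hc
  have hr : ∀ j, szego (a j) = r (a j) + ∑ k, c (a j) k • szego (μ k) := fun j => by
    rw [hc]; abel
  simp only [h2Norm_partialFraction_sub ha hμ]
  constructor
  · refine ⟨fun k => ∑ j, c (a j) k • R j, ?_⟩
    simp only
    congr 1
    refine Finset.sum_congr rfl fun s _ => Finset.sum_congr rfl fun t _ => ?_
    congr 2
    rw [sub_eq_iff_eq_add]
    simp only [Matrix.sum_apply, Matrix.smul_apply, Finset.sum_smul]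
    rw [Finset.sum_comm, ← Finset.sum_add_distrib]
    refine Finset.sum_congr rfl fun j _ => ?_
    conv_lhs => rw [hr j]
    rw [smul_add, Finset.smul_sum]
    congr 1
    refine Finset.sum_congr rfl fun k _ => ?_
    rw [smul_smul, smul_eq_mul, mul_comm]
  · rintro _ ⟨R', rfl⟩
    refine Real.sqrt_le_sqrt (Finset.sum_le_sum fun s _ => Finset.sum_le_sum fun t _ => ?_)
    gcongr
    set w := ∑ j, R j s t • r (a j) with hw
    set y := ∑ i, R i s t • szego (a i) - ∑ k, R' k s t • szego (μ k) with hy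
    have hmem : ∀ k, szego (μ k) ∈
        Submodule.span ℂ (szego '' (Finset.univ.image μ : Finset ℂ)) := fun k =>
      Submodule.subset_span ⟨μ k, by simp, rfl⟩
    -- Any competitor `y` differs from the residual `w` by an element of the span, so Pythagoras
    -- gives ‖w‖ ≤ ‖y‖.
    have hyw : y - w ∈ Submodule.span ℂ (szego '' (Finset.univ.image μ : Finset ℂ)) := by
      have : y - w = ∑ i, R i s t • (szego (a i) - r (a i)) - ∑ k, R' k s t • szego (μ k) := by
        simp only [hy, hw, smul_sub, Finset.sum_sub_distrib]; abel
      rw [this]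
      exact sub_mem (sum_mem fun i _ => Submodule.smul_mem _ _ (h1 _))
        (sum_mem fun k _ => Submodule.smul_mem _ _ (hmem k))
    have horth : inner ℂ (y - w) w = 0 := by
      refine inner_eq_zero_of_mem_span (fun ν hν => ?_) hyw
      rw [hw, inner_sum]
      refine Finset.sum_eq_zero fun j _ => ?_
      rw [inner_smul_right, h2 _ (ha j) ν hν, mul_zero]
    have hpy := norm_add_sq_eq_norm_sq_add_norm_sq_of_inner_eq_zero (y - w) w horth
    rw [sub_add_cancel] at hpy
    nlinarith [norm_nonneg (y - w), norm_nonneg w, norm_nonneg y]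

theorem norm_lt_one_of_image {q : ℕ} {μ : Fin q → ℂ} (hμ : ∀ k, ‖μ k‖ < 1) :
    ∀ ν ∈ Finset.univ.image μ, ‖ν‖ < 1 := by
  simpa using hμ

theorem isLeast_range_h2Norm {p m n q : ℕ} {a : Fin n → ℂ} (ha : ∀ i, ‖a i‖ < 1)
    {μ : Fin q → ℂ} (hμ : ∀ k, ‖μ k‖ < 1) (R : Fin n → Matrix (Fin p) (Fin m) ℂ) :
    IsLeast (Set.range fun R' : Fin q → Matrix (Fin p) (Fin m) ℂ =>
        h2Norm (partialFraction a R - partialFraction μ R'))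
      (optimalError μ (partialFraction a R)) := by
  obtain ⟨r, h1, h2, -⟩ := exists_residual_norm _ (norm_lt_one_of_image hμ)
  have h := isLeast_optimalError ha hμ R h1 h2
  rwa [optimalError, iInf, h.csInf_eq]

theorem optimalError_le {p m n q : ℕ} {a : Fin n → ℂ} (ha : ∀ i, ‖a i‖ < 1)
    {μ : Fin q → ℂ} (hμ : ∀ k, ‖μ k‖ < 1) (R : Fin n → Matrix (Fin p) (Fin m) ℂ) :
    optimalError μ (partialFraction a R) ≤
      ∑ j, ‖R j‖ * resNorm (Finset.univ.image μ) (a j) := by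
  obtain ⟨r, h1, h2, h3⟩ := exists_residual_norm _ (norm_lt_one_of_image hμ)
  rw [optimalError, iInf, (isLeast_optimalError ha hμ R h1 h2).csInf_eq]
  refine (sqrt_sum_norm_sq_le R fun j => r (a j)).trans_eq (Finset.sum_congr rfl fun j _ => ?_)
  rw [h3 _ (ha j)]

theorem optimalError_single {p m q : ℕ} {a : ℂ} (ha : ‖a‖ < 1)
    {μ : Fin q → ℂ} (hμ : ∀ k, ‖μ k‖ < 1) (R : Matrix (Fin p) (Fin m) ℂ) :
    optimalError μ (partialFraction (fun _ : Fin 1 => a) fun _ => R) =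
      ‖R‖ * resNorm (Finset.univ.image μ) a := by
  obtain ⟨r, h1, h2, h3⟩ := exists_residual_norm _ (norm_lt_one_of_image hμ)
  rw [optimalError, iInf, (isLeast_optimalError (fun _ => ha) hμ _ h1 h2).csInf_eq, ← h3 _ ha,
    ← Real.sqrt_sq (mul_nonneg (norm_nonneg R) (norm_nonneg (r a))), mul_pow, frobenius_norm_sq]
  simp [norm_smul, mul_pow, Finset.sum_mul]

theorem continuousOn_resNorm (S : Finset ℂ) (hS : ∀ μ ∈ S, ‖μ‖ < 1) :
    ContinuousOn (resNorm S) (Metric.ball 0 1) := by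
  refine ContinuousOn.mul (ContinuousOn.inv₀ (by fun_prop) fun z hz => ?_)
    (continuousOn_finsetProd _ fun μ hμ => ContinuousOn.norm (ContinuousOn.div (by fun_prop)
      (by fun_prop) fun z hz => ?_))
  · exact (Real.sqrt_pos.mpr (one_sub_norm_sq_pos (by simpa using hz))).ne'
  · exact one_sub_conj_mul_ne_zero (hS μ hμ) (by simpa using hz)

/-- The worst case is attained by a system with a single pole. -/
theorem exists_isGreatest_optimalError {p m : ℕ} (hp : 0 < p) (hm : 0 < m) {D : Set ℂ}
    (hDc : IsCompact D) (hDn : D.Nonempty) (hD : D ⊆ Metric.ball (0 : ℂ) 1) {Rbar : ℝ}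
    (hR : 0 < Rbar) {q : ℕ} {μ : Fin q → ℂ} (hμ : ∀ k, ‖μ k‖ < 1) :
    ∃ a ∈ D, (∀ b ∈ D, resNorm (Finset.univ.image μ) b ≤ resNorm (Finset.univ.image μ) a) ∧
      worstCaseError p m D Rbar μ = Rbar * resNorm (Finset.univ.image μ) a ∧
      IsGreatest (optimalError μ '' systemClass p m D Rbar) (worstCaseError p m D Rbar μ) := by
  have hlt : ∀ b ∈ D, ‖b‖ < 1 := fun b hb => by simpa using hD hb
  obtain ⟨a, haD, ha⟩ := hDc.exists_isMaxOn hDn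
    ((continuousOn_resNorm _ (norm_lt_one_of_image hμ)).mono hD)
  have hmax : ∀ b ∈ D, resNorm (Finset.univ.image μ) b ≤ resNorm (Finset.univ.image μ) a := ha
  have hG : IsGreatest (optimalError μ '' systemClass p m D Rbar)
      (Rbar * resNorm (Finset.univ.image μ) a) := by
    constructor
    -- The whole residue budget goes into one matrix entry, at a maximizer `a` of the distance.
    · set R : Matrix (Fin p) (Fin m) ℂ := Matrix.single ⟨0, hp⟩ ⟨0, hm⟩ (Rbar : ℂ) with hRdef
      have hnorm : ‖R‖ = Rbar := by
        rw [← Real.sqrt_sq (norm_nonneg R), frobenius_norm_sq, Finset.sum_eq_single ⟨0, hp⟩,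
          Finset.sum_eq_single ⟨0, hm⟩]
        · simp [hRdef, Real.sqrt_sq_eq_abs, abs_of_pos hR]
        · intro t _ ht; simp [hRdef, ht.symm]
        · simp
        · intro s _ hs; simp [hRdef, hs.symm]
        · simp
      refine ⟨partialFraction (fun _ : Fin 1 => a) fun _ => R,
        ⟨1, _, _, Function.injective_of_subsingleton _, fun _ => haD, ?_, rfl⟩, ?_⟩
      · simp [hnorm]
      · rw [optimalError_single (hlt a haD) hμ, hnorm]
    · rintro _ ⟨_, ⟨n, lam, R, -, hlam, hsum, rfl⟩, rfl⟩
      refine (optimalError_le (fun j => hlt _ (hlam j)) hμ R).trans ?_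
      refine le_trans (Finset.sum_le_sum fun j _ =>
        mul_le_mul_of_nonneg_left (hmax _ (hlam j)) (norm_nonneg _)) ?_
      rw [← Finset.sum_mul]
      exact mul_le_mul_of_nonneg_right hsum (resNorm_nonneg _ _)
  have hE : worstCaseError p m D Rbar μ = Rbar * resNorm (Finset.univ.image μ) a := by
    rw [worstCaseError, iSup, ← hG.csSup_eq, Set.image_eq_range]
  exact ⟨a, haD, hmax, hE, hE ▸ hG⟩

end Frobenius

/-! ### Existence of the Chebyshev constant -/

theorem pseudoHyp_comm (z μ : ℂ) : pseudoHyp z μ = pseudoHyp μ z := by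
  have h : ‖1 - (starRingEnd ℂ) μ * z‖ = ‖1 - (starRingEnd ℂ) z * μ‖ := by
    rw [← RCLike.norm_conj (1 - (starRingEnd ℂ) μ * z)]
    simp [mul_comm]
  rw [pseudoHyp, pseudoHyp, norm_div, norm_div, norm_sub_rev, h]

theorem pseudoHyp_self (z : ℂ) : pseudoHyp z z = 0 := by simp [pseudoHyp]

/-- |1 - μ̄z|² - |z - μ|² = (1 - |z|²)(1 - |μ|²) > 0. -/
theorem pseudoHyp_le_one {z μ : ℂ} (hz : ‖z‖ < 1) (hμ : ‖μ‖ < 1) : pseudoHyp z μ ≤ 1 := by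
  rw [pseudoHyp, norm_div, div_le_one (norm_pos_iff.mpr (one_sub_conj_mul_ne_zero hμ hz)),
    ← sq_le_sq₀ (norm_nonneg _) (norm_nonneg _), ← Complex.normSq_eq_norm_sq,
    ← Complex.normSq_eq_norm_sq, Complex.normSq_apply, Complex.normSq_apply]
  have h1 := one_sub_norm_sq_pos hz
  have h2 := one_sub_norm_sq_pos hμ
  rw [← Complex.normSq_eq_norm_sq, Complex.normSq_apply] at h1 h2
  simp
  nlinarith [mul_pos h1 h2]

/-- The product of the pseudohyperbolic distances from `z` to the points `μ k`. -/
noncomputable def hypProd {q : ℕ} (μ : Fin q → ℂ) (z : ℂ) : ℝ := ∏ k, pseudoHyp z (μ k)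

theorem hypProd_nonneg {q : ℕ} (μ : Fin q → ℂ) (z : ℂ) : 0 ≤ hypProd μ z :=
  Finset.prod_nonneg fun _ _ => pseudoHyp_nonneg _ _

theorem hypProd_le_one {q : ℕ} {μ : Fin q → ℂ} (hμ : ∀ k, ‖μ k‖ < 1) {z : ℂ} (hz : ‖z‖ < 1) :
    hypProd μ z ≤ 1 :=
  Finset.prod_le_one (fun _ _ => pseudoHyp_nonneg _ _) fun k _ => pseudoHyp_le_one hz (hμ k)

/-- The unnormalized Chebyshev constant `inf_μ sup_z ∏ₖ [z, μₖ]_h`. -/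
noncomputable def minMax (D : Set ℂ) (q : ℕ) : ℝ :=
  ⨅ μ : Fin q → D, ⨆ z : D, hypProd (fun k => μ k) z

theorem bddAbove_hypProd {D : Set ℂ} (hD : ∀ z ∈ D, ‖z‖ < 1) {q : ℕ} (μ : Fin q → D) :
    BddAbove (Set.range fun z : D => hypProd (fun k => μ k) z) :=
  ⟨1, by rintro _ ⟨z, rfl⟩; exact hypProd_le_one (fun k => hD _ (μ k).2) (hD _ z.2)⟩

theorem iSup_hypProd_nonneg {D : Set ℂ} {q : ℕ} (μ : Fin q → D) :
    0 ≤ ⨆ z : D, hypProd (fun k => μ k) z :=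
  Real.iSup_nonneg fun _ => hypProd_nonneg _ _

theorem bddBelow_iSup_hypProd (D : Set ℂ) (q : ℕ) :
    BddBelow (Set.range fun μ : Fin q → D => ⨆ z : D, hypProd (fun k => μ k) z) :=
  ⟨0, by rintro _ ⟨μ, rfl⟩; exact iSup_hypProd_nonneg μ⟩

theorem minMax_nonneg (D : Set ℂ) (q : ℕ) : 0 ≤ minMax D q :=
  Real.iInf_nonneg fun μ => iSup_hypProd_nonneg μ

theorem minMax_le {D : Set ℂ} (hne : D.Nonempty) {q : ℕ} {μ : Fin q → ℂ} (hμ : ∀ k, μ k ∈ D)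
    {c : ℝ} (hc : ∀ z ∈ D, hypProd μ z ≤ c) : minMax D q ≤ c := by
  have := hne.to_subtype
  exact (ciInf_le (bddBelow_iSup_hypProd D q) fun k => ⟨μ k, hμ k⟩).trans
    (ciSup_le fun z => hc z z.2)

theorem le_minMax {D : Set ℂ} (hD : ∀ z ∈ D, ‖z‖ < 1) (hne : D.Nonempty) {q : ℕ} {c : ℝ}
    (hc : ∀ μ : Fin q → ℂ, (∀ k, μ k ∈ D) → ∃ z ∈ D, c ≤ hypProd μ z) : c ≤ minMax D q := by
  have := hne.to_subtype
  refine le_ciInf fun μ => ?_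
  obtain ⟨z, hz, h⟩ := hc (fun k => μ k) fun k => (μ k).2
  exact h.trans (le_ciSup (bddAbove_hypProd hD μ) ⟨z, hz⟩)

theorem minMax_le_one {D : Set ℂ} (hD : ∀ z ∈ D, ‖z‖ < 1) (hne : D.Nonempty) (q : ℕ) :
    minMax D q ≤ 1 := by
  obtain ⟨a, ha⟩ := hne
  exact minMax_le ⟨a, ha⟩ (μ := fun _ => a) (fun _ => ha) fun z hz =>
    hypProd_le_one (fun _ => hD a ha) (hD z hz)

/-- Concatenating two node tuples multiplies their products, and the supremum of a product is at
most the product of the suprema. -/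
theorem minMax_add_le {D : Set ℂ} (hD : ∀ z ∈ D, ‖z‖ < 1) (hne : D.Nonempty) (a b : ℕ) :
    minMax D (a + b) ≤ minMax D a * minMax D b := by
  have := hne.to_subtype
  conv_rhs => rw [minMax]
  rw [Real.iInf_mul_of_nonneg (minMax_nonneg D b)]
  refine le_ciInf fun μ => ?_
  rw [minMax, minMax, Real.mul_iInf_of_nonneg (iSup_hypProd_nonneg μ)]
  refine le_ciInf fun ν => ?_
  refine minMax_le hne (μ := Fin.append (fun k => (μ k : ℂ)) fun k => (ν k : ℂ)) (fun k => ?_)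
    fun z hz => ?_
  · refine Fin.addCases (fun k => ?_) (fun k => ?_) k <;> simp
  · rw [hypProd, Fin.prod_univ_add]
    simp only [Fin.append_left, Fin.append_right]
    exact mul_le_mul (le_ciSup (bddAbove_hypProd hD μ) ⟨z, hz⟩)
      (le_ciSup (bddAbove_hypProd hD ν) ⟨z, hz⟩) (hypProd_nonneg _ _) (iSup_hypProd_nonneg μ)

/-- The q-th root on nonnegative reals is monotone with monotone inverse, so it passes through both
extrema. -/
theorem finiteChebyshev_eq {D : Set ℂ} (hne : D.Nonempty) {q : ℕ} (hq : q ≠ 0) :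
    finiteChebyshev D q = minMax D q ^ (1 / (q : ℝ)) := by
  have := hne.to_subtype
  have hsup : ∀ μ : Fin q → D, (⨆ z : D, hypProd (fun k => μ k) z ^ (1 / (q : ℝ))) =
      (⨆ z : D, hypProd (fun k => μ k) z) ^ (1 / (q : ℝ)) := fun μ => by
    have h : ∀ z, 0 ≤ hypProd (fun k => (μ k : ℂ)) z ^ (1 / (q : ℝ)) := fun z =>
      Real.rpow_nonneg (hypProd_nonneg _ _) _
    have hpow := Real.iSup_pow_of_ne_zero (fun z : D => h z) hq
    simp only [one_div, Real.rpow_inv_natCast_pow (hypProd_nonneg _ _) hq] at hpow ⊢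
    rw [← hpow, Real.pow_rpow_inv_natCast (Real.iSup_nonneg fun z => by simpa using h z) hq]
  change (⨅ μ : Fin q → D, ⨆ z : D, hypProd (fun k => μ k) z ^ (1 / (q : ℝ))) = _
  simp only [hsup]
  refine le_antisymm ?_ (le_ciInf fun μ => Real.rpow_le_rpow (minMax_nonneg D q)
    (ciInf_le (bddBelow_iSup_hypProd D q) μ) (by positivity))
  have hnn : ∀ μ : Fin q → D, 0 ≤ (⨆ z : D, hypProd (fun k => μ k) z) ^ (1 / (q : ℝ)) := fun μ =>
    Real.rpow_nonneg (iSup_hypProd_nonneg μ) _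
  rw [one_div, Real.le_rpow_inv_iff_of_pos (Real.iInf_nonneg fun μ => by simpa using hnn μ)
    (minMax_nonneg D q) (by positivity)]
  refine le_ciInf fun μ => ?_
  rw [← Real.le_rpow_inv_iff_of_pos (Real.iInf_nonneg fun μ => by simpa using hnn μ)
    (iSup_hypProd_nonneg μ) (by positivity)]
  exact ciInf_le ⟨0, by rintro _ ⟨μ, rfl⟩; simpa using hnn μ⟩ μ

/-- Fekete's lemma in multiplicative form. -/
theorem exists_tendsto_rpow_of_submultiplicative {u : ℕ → ℝ} (h0 : ∀ n, 0 ≤ u n)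
    (h1 : ∀ n, u n ≤ 1) (hm : ∀ a b, u (a + b) ≤ u a * u b) :
    ∃ τ, Tendsto (fun n : ℕ => u n ^ (1 / (n : ℝ))) atTop (𝓝 τ) := by
  set S := (fun n : ℕ => u n ^ (1 / (n : ℝ))) '' Set.Ici 1 with hS
  have hbdd : BddBelow S := ⟨0, by rintro _ ⟨n, -, rfl⟩; exact Real.rpow_nonneg (h0 n) _⟩
  have hSne : S.Nonempty := ⟨_, 1, Set.mem_Ici.mpr le_rfl, rfl⟩
  refine ⟨sInf S, tendsto_order.2 ⟨fun a ha => ?_, fun s hs => ?_⟩⟩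
  · filter_upwards [eventually_ge_atTop 1] with n hn
    exact ha.trans_le (csInf_le hbdd ⟨n, hn, rfl⟩)
  · obtain ⟨t, ht, hts⟩ := exists_between hs
    obtain ⟨_, ⟨n, hn, rfl⟩, hnt⟩ := exists_lt_of_csInf_lt hSne ht
    have hn0 : n ≠ 0 := Nat.one_le_iff_ne_zero.mp hn
    have ht0 : 0 < t := (Real.rpow_nonneg (h0 n) _).trans_lt hnt
    have hun : u n ≤ t ^ n := by
      have := pow_le_pow_left₀ (Real.rpow_nonneg (h0 n) _) hnt.le n
      rwa [one_div, Real.rpow_inv_natCast_pow (h0 n) hn0] at this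
    have hmul : ∀ k, u (n * k) ≤ t ^ (n * k) := fun k => by
      induction k with
      | zero => simpa using h1 0
      | succ k ih =>
        rw [Nat.mul_succ, pow_add]
        exact (hm _ _).trans (mul_le_mul ih hun (h0 _) (by positivity))
    -- The bound `u ≤ 1` discards the remainder factor `u (q % n)`; the exponent that is left is
    -- asymptotic to `q`.
    have hle : ∀ q, u q ≤ t ^ (n * (q / n)) := fun q => by
      conv_lhs => rw [← Nat.div_add_mod q n]
      exact (hm _ _).trans ((mul_le_of_le_one_right (h0 _) (h1 _)).trans (hmul _))
    have hexp : Tendsto (fun q : ℕ => ((n * (q / n) : ℕ) : ℝ) * (1 / (q : ℝ))) atTop (𝓝 1) := by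
      have hlow : Tendsto (fun q : ℕ => 1 - (n : ℝ) / q) atTop (𝓝 1) := by
        simpa using (tendsto_const_div_atTop_nhds_zero_nat (n : ℝ)).const_sub 1
      refine tendsto_of_tendsto_of_tendsto_of_le_of_le' hlow tendsto_const_nhds ?_ ?_
      · filter_upwards [eventually_ge_atTop 1] with q hq
        have hq0 : (0 : ℝ) < q := by exact_mod_cast hq
        have h : (q : ℝ) ≤ ((n * (q / n) : ℕ) : ℝ) + n := by
          have := Nat.div_add_mod q n
          have := Nat.mod_lt q (Nat.pos_of_ne_zero hn0)
          exact_mod_cast (by lia : q ≤ n * (q / n) + n)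
        rw [mul_one_div, one_sub_div hq0.ne']
        gcongr
        linarith
      · filter_upwards [eventually_ge_atTop 1] with q hq
        have hq0 : (0 : ℝ) < q := by exact_mod_cast hq
        rw [mul_one_div, div_le_one hq0]
        exact_mod_cast Nat.mul_div_le q n
    have hlim : Tendsto (fun q : ℕ => t ^ (((n * (q / n) : ℕ) : ℝ) * (1 / (q : ℝ)))) atTop
        (𝓝 t) := by
      simpa using (tendsto_const_nhds (x := t)).rpow hexp (Or.inl ht0.ne')
    filter_upwards [hlim.eventually_lt_const hts] with q hq
    refine lt_of_le_of_lt ?_ hq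
    rw [Real.rpow_mul ht0.le, Real.rpow_natCast]
    exact Real.rpow_le_rpow (h0 q) (hle q) (by positivity)

/-! ### Tsuji points -/

/-- The product of the pairwise pseudohyperbolic distances. -/
noncomputable def pairProd {q : ℕ} (w : Fin q → ℂ) : ℝ :=
  ∏ j, ∏ k ∈ Finset.Ioi j, pseudoHyp (w j) (w k)

theorem pairProd_pos {q : ℕ} {w : Fin q → ℂ} (hw : ∀ k, ‖w k‖ < 1) (hinj : Function.Injective w) :
    0 < pairProd w :=
  Finset.prod_pos fun j _ => Finset.prod_pos fun k hk =>
    pseudoHyp_pos (hw j) (hw k) (hinj.ne (Finset.mem_Ioi.mp hk).ne)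

theorem injective_of_pairProd_pos {q : ℕ} {w : Fin q → ℂ} (h : 0 < pairProd w) :
    Function.Injective w := by
  have hlt : ∀ i j, i < j → w i ≠ w j := fun i j hij hw => by
    refine h.ne' (Finset.prod_eq_zero (Finset.mem_univ i)
      (Finset.prod_eq_zero (Finset.mem_Ioi.mpr hij) ?_))
    rw [hw, pseudoHyp_self]
  intro i j hw
  rcases lt_trichotomy i j with hij | hij | hij
  · exact absurd hw (hlt i j hij)
  · exact hij
  · exact absurd hw.symm (hlt j i hij)

theorem pairProd_eq {q : ℕ} (w : Fin (q + 1) → ℂ) (i : Fin (q + 1)) :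
    pairProd w = hypProd (w ∘ i.succAbove) (w i) * pairProd (w ∘ i.succAbove) := by
  -- Products over all indices, padded with ones, can both be split at `i`.
  have hIoi : ∀ {n : ℕ} (j : Fin n) (f : Fin n → ℝ),
      ∏ k ∈ Finset.Ioi j, f k = ∏ k, if j < k then f k else 1 := fun j f => by
    rw [← Finset.prod_filter]; congr 1; ext; simp
  simp only [pairProd, hypProd, hIoi]
  rw [Fin.prod_univ_succAbove _ i, Fin.prod_univ_succAbove _ i]
  simp only [lt_irrefl, if_false, one_mul]
  rw [Finset.prod_congr rfl fun j _ => Fin.prod_univ_succAbove _ i, Finset.prod_mul_distrib,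
    ← mul_assoc, ← Finset.prod_mul_distrib]
  congr 1
  · refine Finset.prod_congr rfl fun j _ => ?_
    rcases (Fin.succAbove_ne i j).lt_or_gt with h | h
    · simp [h, h.not_gt, pseudoHyp_comm (w i)]
    · simp [h, h.not_gt]
  · simp [Fin.succAbove_lt_succAbove_iff]

theorem continuousOn_pairProd {q : ℕ} :
    ContinuousOn (pairProd (q := q)) (Set.univ.pi fun _ => Metric.ball 0 1) := by
  refine continuousOn_finsetProd _ fun j _ => continuousOn_finsetProd _ fun k _ =>
    ContinuousOn.norm (ContinuousOn.div (by fun_prop) ?_ fun w hw => ?_)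
  · exact (continuous_const.sub ((Complex.continuous_conj.comp (continuous_apply k)).mul
      (continuous_apply j))).continuousOn
  · rw [Set.mem_univ_pi] at hw
    exact one_sub_conj_mul_ne_zero (by simpa using hw k) (by simpa using hw j)

theorem exists_isTsuji {D : Set ℂ} (hDc : IsCompact D) (hne : D.Nonempty)
    (hD : D ⊆ Metric.ball (0 : ℂ) 1) (q : ℕ) : ∃ η : Fin q → ℂ, IsTsuji D η := by
  obtain ⟨η, hη, hmax⟩ := (isCompact_univ_pi fun _ : Fin q => hDc).exists_isMaxOn
    (Set.univ_pi_nonempty_iff.mpr fun _ => hne)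
    (continuousOn_pairProd.mono (Set.pi_mono fun _ _ => hD))
  exact ⟨η, fun k => hη k trivial, fun w hw => hmax fun k _ => hw k⟩

/-- An infinite `D` contains q distinct points, and their positive product is a lower bound for the
maximum. -/
theorem IsTsuji.pairProd_pos {D : Set ℂ} (hD : ∀ z ∈ D, ‖z‖ < 1) (hinf : D.Infinite) {q : ℕ}
    {η : Fin q → ℂ} (h : IsTsuji D η) : 0 < pairProd η := by
  have := hinf.to_subtype
  let e := (Fin.valEmbedding (n := q)).trans (Infinite.natEmbedding D)
  exact (OBF.pairProd_pos (w := fun k => (e k : ℂ)) (fun k => hD _ (e k).2)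
    (Subtype.val_injective.comp e.injective)).trans_le (h.2 _ fun k => (e k).2)

/-- Moving the i-th point to `z` cannot increase the pair product; the pairs avoiding i form a
common positive factor that cancels. -/
theorem IsTsuji.hypProd_le {D : Set ℂ} {q : ℕ} {η : Fin (q + 1) → ℂ} (h : IsTsuji D η)
    (hpos : 0 < pairProd η) (i : Fin (q + 1)) {z : ℂ} (hz : z ∈ D) :
    hypProd (η ∘ i.succAbove) z ≤ hypProd (η ∘ i.succAbove) (η i) := by
  have hle : pairProd (i.insertNth z (η ∘ i.succAbove) : Fin (q + 1) → ℂ) ≤ pairProd η := by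
    refine h.2 _ fun k => ?_
    refine Fin.succAboveCases i ?_ (fun j => ?_) k
    · simpa using hz
    · simpa using h.1 _
  have hcomp : (i.insertNth z (η ∘ i.succAbove) : Fin (q + 1) → ℂ) ∘ i.succAbove =
      η ∘ i.succAbove := by ext j; simp
  rw [pairProd_eq _ i, pairProd_eq η i, hcomp, Fin.insertNth_apply_same] at hle
  rw [pairProd_eq η i] at hpos
  exact le_of_mul_le_mul_right hle (pos_of_mul_pos_right hpos (hypProd_nonneg _ _))

/-- Deleting any point of (a, η) leaves a q-tuple in `D` with pair product at most that of η, so the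
factor lost is at least the one lost by deleting `a`. -/
theorem IsTsuji.hypProd_le_cons {D : Set ℂ} {q : ℕ} {η : Fin q → ℂ} (h : IsTsuji D η)
    (hpos : 0 < pairProd η) {a : ℂ} (ha : a ∈ D) (i : Fin (q + 1)) :
    hypProd η a ≤ hypProd ((Fin.cons a η : Fin (q + 1) → ℂ) ∘ i.succAbove)
      ((Fin.cons a η : Fin (q + 1) → ℂ) i) := by
  set z : Fin (q + 1) → ℂ := Fin.cons a η with hz
  have hzD : ∀ k, z k ∈ D := fun k => Fin.cases (by simpa [hz] using ha)
    (fun j => by simpa [hz] using h.1 j) k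
  have h0 : pairProd z = hypProd η a * pairProd η := by
    rw [pairProd_eq z 0]
    congr 2
  have hle : pairProd (z ∘ i.succAbove) ≤ pairProd η := h.2 _ fun k => hzD _
  rw [pairProd_eq z i] at h0
  refine le_of_mul_le_mul_right ?_ hpos
  rw [← h0]
  exact mul_le_mul_of_nonneg_left hle (hypProd_nonneg _ _)

/-! ### Comparison with the Chebyshev constant -/

/-- `resNorm` sees only distinct poles while `hypProd` counts multiplicity; injectivity reconciles
them. -/
theorem resNorm_image {q : ℕ} {x : Fin q → ℂ} (hx : Function.Injective x) (a : ℂ) :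
    resNorm (Finset.univ.image x) a = (Real.sqrt (1 - ‖a‖ ^ 2))⁻¹ * hypProd x a := by
  rw [resNorm, Finset.prod_image fun i _ j _ h => hx h, hypProd]

theorem one_le_inv_sqrt {a : ℂ} (ha : ‖a‖ < 1) : 1 ≤ (Real.sqrt (1 - ‖a‖ ^ 2))⁻¹ :=
  (one_le_inv₀ (Real.sqrt_pos.mpr (one_sub_norm_sq_pos ha))).mpr
    (Real.sqrt_le_one.mpr (by nlinarith [norm_nonneg a]))

theorem hypProd_le_resNorm {q : ℕ} {x : Fin q → ℂ} (hx : Function.Injective x) {a : ℂ}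
    (ha : ‖a‖ < 1) : hypProd x a ≤ resNorm (Finset.univ.image x) a := by
  rw [resNorm_image hx]
  exact le_mul_of_one_le_left (hypProd_nonneg _ _) (one_le_inv_sqrt ha)

theorem one_le_sum_hypProd_div_of_injective {q : ℕ} {z : Fin (q + 1) → ℂ} (hz : ∀ i, ‖z i‖ < 1)
    (hinj : Function.Injective z) {x : Fin q → ℂ} (hx : ∀ k, ‖x k‖ < 1)
    (hxinj : Function.Injective x) :
    1 ≤ ∑ i, hypProd x (z i) / hypProd (z ∘ i.succAbove) (z i) := by
  refine (one_le_sum_resNorm_div hz hinj hx).trans_eq (Finset.sum_congr rfl fun i _ => ?_)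
  rw [resNorm_image hxinj, resNorm_image (hinj.comp Fin.succAbove_right_injective),
    mul_div_mul_left]
  exact (zero_lt_one.trans_le (one_le_inv_sqrt (hz i))).ne'

theorem eventually_injective_add {q : ℕ} (x : Fin q → ℂ) :
    ∀ᶠ ε : ℂ in 𝓝[≠] 0, Function.Injective fun k : Fin q => x k + ε * (k : ℕ) := by
  have h : ∀ i j : Fin q, ∀ᶠ ε : ℂ in 𝓝[≠] 0,
      x i + ε * (i : ℕ) = x j + ε * (j : ℕ) → i = j := fun i j => by
    by_cases hij : i = j
    · exact Eventually.of_forall fun _ _ => hij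
    by_cases hx : x i = x j
    · filter_upwards [self_mem_nhdsWithin] with ε hε h
      rw [hx, add_right_inj] at h
      exact Fin.ext (by exact_mod_cast mul_left_cancel₀ hε h)
    · have hc : ContinuousAt (fun ε : ℂ => x i + ε * (i : ℕ) - (x j + ε * (j : ℕ))) 0 := by
        fun_prop
      have := hc.eventually_ne (y := 0) (by simpa using sub_ne_zero.mpr hx)
      filter_upwards [nhdsWithin_le_nhds this] with ε hε h
      exact absurd (sub_eq_zero.mpr h) hε
  filter_upwards [eventually_all.mpr fun i => eventually_all.mpr (h i)] with ε hε i j hij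
  exact hε i j hij

/-- Competitors for `minMax` may repeat points. The perturbation x_k + εk makes them distinct for
small ε ≠ 0, and the inequality survives ε → 0. -/
theorem one_le_sum_hypProd_div {q : ℕ} {z : Fin (q + 1) → ℂ} (hz : ∀ i, ‖z i‖ < 1)
    (hinj : Function.Injective z) {x : Fin q → ℂ} (hx : ∀ k, ‖x k‖ < 1) :
    1 ≤ ∑ i, hypProd x (z i) / hypProd (z ∘ i.succAbove) (z i) := by
  let y : ℂ → Fin q → ℂ := fun ε k => x k + ε * (k : ℕ)
  have hy0 : y 0 = x := by ext; simp [y]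
  have hyc : ∀ k, ContinuousAt (fun ε => y ε k) 0 := fun k => by
    simp only [y]; fun_prop
  have hlim : Tendsto (fun ε => ∑ i, hypProd (y ε) (z i) / hypProd (z ∘ i.succAbove) (z i))
      (𝓝[≠] 0) (𝓝 (∑ i, hypProd x (z i) / hypProd (z ∘ i.succAbove) (z i))) := by
    refine Tendsto.mono_left ?_ nhdsWithin_le_nhds
    refine tendsto_finsetSum _ fun i _ => Tendsto.div_const ?_ _
    refine tendsto_finsetProd _ fun k _ => ?_
    have hc : ContinuousAt (fun ε => pseudoHyp (z i) (y ε k)) 0 := by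
      refine ContinuousAt.norm (ContinuousAt.div (continuousAt_const.sub (hyc k))
        (continuousAt_const.sub ((Complex.continuous_conj.continuousAt.comp (hyc k)).mul
          continuousAt_const)) ?_)
      rw [hy0]
      exact one_sub_conj_mul_ne_zero (hx k) (hz i)
    have := hc.tendsto
    rwa [hy0] at this
  refine ge_of_tendsto hlim ?_
  have hlt : ∀ᶠ ε in 𝓝[≠] (0 : ℂ), ∀ k, ‖y ε k‖ < 1 :=
    nhdsWithin_le_nhds (eventually_all.mpr fun k =>
      (hyc k).norm.eventually_lt continuousAt_const (by simpa [hy0] using hx k))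
  filter_upwards [eventually_injective_add x, hlt] with ε h1 h2
  exact one_le_sum_hypProd_div_of_injective hz hinj h2 h1

theorem minMax_eq_zero {a : ℂ} {q : ℕ} (hq : q ≠ 0) : minMax {a} q = 0 := by
  refine le_antisymm (minMax_le (Set.singleton_nonempty a) (μ := fun _ => a) (fun _ => rfl)
    fun z hz => ?_) (minMax_nonneg _ _)
  rw [Set.mem_singleton_iff.mp hz]
  simp [hypProd, pseudoHyp_self, hq]

theorem IsTsuji.injective {D : Set ℂ} (hD : ∀ z ∈ D, ‖z‖ < 1) (hinf : D.Infinite) {q : ℕ}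
    {η : Fin q → ℂ} (h : IsTsuji D η) : Function.Injective η :=
  injective_of_pairProd_pos (h.pairProd_pos hD hinf)

/-- In the dimension count for the (q + 1)-th Tsuji points, each point maximizes the product over
the others, so all q + 1 denominators are at least `minMax D q`. -/
theorem minMax_div_le_resNorm {D : Set ℂ} (hDc : IsCompact D) (hne : D.Nonempty)
    (hD : D ⊆ Metric.ball (0 : ℂ) 1) (hinf : D.Infinite) {q : ℕ} {μ : Fin q → ℂ}
    (hμ : ∀ k, ‖μ k‖ < 1) {a : ℂ}
    (ha : ∀ b ∈ D, resNorm (Finset.univ.image μ) b ≤ resNorm (Finset.univ.image μ) a) :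
    minMax D q / (q + 1) ≤ resNorm (Finset.univ.image μ) a := by
  have hlt : ∀ b ∈ D, ‖b‖ < 1 := fun b hb => by simpa using hD hb
  rcases (minMax_nonneg D q).eq_or_lt with h0 | hpos
  · rw [← h0, zero_div]; exact resNorm_nonneg _ _
  obtain ⟨η, hη⟩ := exists_isTsuji hDc hne hD (q + 1)
  have hinj := hη.injective hlt hinf
  have hden : ∀ i : Fin (q + 1),
      minMax D q ≤ resNorm (Finset.univ.image (η ∘ i.succAbove)) (η i) := fun i =>
    (minMax_le hne (fun k => hη.1 _) fun z hz =>
      hη.hypProd_le (hη.pairProd_pos hlt hinf) i hz).trans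
      (hypProd_le_resNorm (hinj.comp Fin.succAbove_right_injective) (hlt _ (hη.1 i)))
  have hsum : 1 ≤ ∑ _i : Fin (q + 1), resNorm (Finset.univ.image μ) a / minMax D q :=
    (one_le_sum_resNorm_div (fun i => hlt _ (hη.1 i)) hinj hμ).trans
      (Finset.sum_le_sum fun i _ => div_le_div₀ (resNorm_nonneg _ _) (ha _ (hη.1 i)) hpos (hden i))
  rw [Finset.sum_const, Finset.card_univ, Fintype.card_fin, nsmul_eq_mul, ← mul_div_assoc,
    one_le_div hpos] at hsum
  rw [div_le_iff₀ (by positivity), mul_comm]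
  exact_mod_cast hsum

/-- For arbitrary nodes `x` in `D`, the dimension count at (a, η) yields a point of `D` where
`hypProd x` is at least `hypProd η a / (q + 1)`. -/
theorem IsTsuji.hypProd_le_minMax {D : Set ℂ} (hne : D.Nonempty) (hlt : ∀ b ∈ D, ‖b‖ < 1)
    (hinf : D.Infinite) {q : ℕ} {η : Fin q → ℂ} (hη : IsTsuji D η) {a : ℂ} (ha : a ∈ D) :
    hypProd η a ≤ (q + 1) * minMax D q := by
  rcases (hypProd_nonneg η a).eq_or_lt with h0 | hpos
  · rw [← h0]; exact mul_nonneg (by positivity) (minMax_nonneg _ _)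
  have haη : ∀ k, a ≠ η k := fun k h =>
    hpos.ne' (Finset.prod_eq_zero (Finset.mem_univ k) (by rw [← h, pseudoHyp_self]))
  set z : Fin (q + 1) → ℂ := Fin.cons a η with hz
  have hzD : ∀ k, z k ∈ D := fun k => Fin.cases (by simpa [hz] using ha)
    (fun j => by simpa [hz] using hη.1 j) k
  have hinj : Function.Injective z := Fin.cons_injective_iff.mpr
    ⟨by rintro ⟨k, hk⟩; exact haη k hk.symm, hη.injective hlt hinf⟩
  rw [mul_comm, ← div_le_iff₀ (by positivity)]
  refine le_minMax hlt hne fun x hx => ?_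
  have h1 := one_le_sum_hypProd_div (fun i => hlt _ (hzD i)) hinj fun k => hlt _ (hx k)
  have h2 : 1 ≤ ∑ i, hypProd x (z i) / hypProd η a :=
    h1.trans (Finset.sum_le_sum fun i _ => div_le_div_of_nonneg_left (hypProd_nonneg _ _) hpos
      (hη.hypProd_le_cons (hη.pairProd_pos hlt hinf) ha i))
  rw [← Finset.sum_div, one_le_div hpos] at h2
  have h3 : ∑ _i : Fin (q + 1), hypProd η a / (q + 1) ≤ ∑ i, hypProd x (z i) := by
    rw [Finset.sum_const, Finset.card_univ, Fintype.card_fin, nsmul_eq_mul]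
    push_cast
    rwa [mul_div_cancel₀ _ (by positivity)]
  obtain ⟨i, -, hi⟩ := Finset.exists_le_of_sum_le Finset.univ_nonempty h3
  exact ⟨z i, hzD i, hi⟩

theorem tendsto_rpow_one_div_const {c : ℝ} (hc : 0 < c) :
    Tendsto (fun q : ℕ => c ^ (1 / (q : ℝ))) atTop (𝓝 1) := by
  simpa using (tendsto_const_nhds (x := c)).rpow (tendsto_const_div_atTop_nhds_zero_nat (1 : ℝ))
    (Or.inl hc.ne')

theorem tendsto_rpow_one_div_add_one :
    Tendsto (fun q : ℕ => ((q : ℝ) + 1) ^ (1 / (q : ℝ))) atTop (𝓝 1) := by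
  -- With x = q + 1 the expression is x^(1/(x - 1)).
  have h := (tendsto_rpow_div_mul_add 1 1 (-1) zero_ne_one).comp
    (tendsto_atTop_add_const_right atTop (1 : ℝ) tendsto_natCast_atTop_atTop)
  refine h.congr fun q => ?_
  simp

/-! ### Two-sided bounds for the worst-case error -/

section Bounds

variable {p m : ℕ} {D : Set ℂ} {Rbar : ℝ}

theorem le_worstCaseError (hp : 0 < p) (hm : 0 < m) (hDc : IsCompact D) (hDn : IsConnected D)
    (hD : D ⊆ Metric.ball (0 : ℂ) 1) (hR : 0 < Rbar) {q : ℕ} (hq : q ≠ 0) {μ : Fin q → ℂ}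
    (hμ : ∀ k, ‖μ k‖ < 1) :
    Rbar * (minMax D q / (q + 1)) ≤ worstCaseError p m D Rbar μ := by
  obtain ⟨a, haD, hmax, hE, -⟩ := exists_isGreatest_optimalError hp hm hDc hDn.nonempty hD hR hμ
  rw [hE]
  refine mul_le_mul_of_nonneg_left ?_ hR.le
  -- A connected set with two points is infinite, as the Tsuji argument needs; for one point
  -- `minMax` vanishes.
  rcases D.subsingleton_or_nontrivial with hs | hn
  · obtain rfl := hs.eq_singleton_of_mem haD
    rw [minMax_eq_zero hq, zero_div]
    exact resNorm_nonneg _ _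
  · exact minMax_div_le_resNorm hDc hDn.nonempty hD
      (hDn.isPreconnected.infinite_of_nontrivial hn) hμ hmax

theorem exists_inv_sqrt_le (hDc : IsCompact D) (hne : D.Nonempty)
    (hD : D ⊆ Metric.ball (0 : ℂ) 1) :
    ∃ C : ℝ, 0 < C ∧ ∀ a ∈ D, (Real.sqrt (1 - ‖a‖ ^ 2))⁻¹ ≤ C := by
  obtain ⟨b, hb, hmax⟩ := hDc.exists_isMaxOn hne
    ((continuousOn_resNorm ∅ (by simp)).mono hD)
  refine ⟨resNorm ∅ b, resNorm_pos (by simp) (by simpa using hD hb) (by simp), fun a ha => ?_⟩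
  simpa [resNorm] using hmax ha

/-- A crude bound uniform in q, which keeps the real-valued liminf meaningful. -/
theorem worstCaseError_le (hp : 0 < p) (hm : 0 < m) (hDc : IsCompact D) (hDn : D.Nonempty)
    (hD : D ⊆ Metric.ball (0 : ℂ) 1) (hR : 0 < Rbar) {C : ℝ}
    (hC : ∀ a ∈ D, (Real.sqrt (1 - ‖a‖ ^ 2))⁻¹ ≤ C) {q : ℕ} {μ : Fin q → ℂ}
    (hμ : ∀ k, ‖μ k‖ < 1) : 0 ≤ worstCaseError p m D Rbar μ ∧
      worstCaseError p m D Rbar μ ≤ Rbar * C := by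
  have hlt : ∀ b ∈ D, ‖b‖ < 1 := fun b hb => by simpa using hD hb
  obtain ⟨a, haD, -, hE, -⟩ := exists_isGreatest_optimalError hp hm hDc hDn hD hR hμ
  rw [hE]
  refine ⟨mul_nonneg hR.le (resNorm_nonneg _ _), mul_le_mul_of_nonneg_left ?_ hR.le⟩
  refine (mul_le_of_le_one_right (by positivity) (Finset.prod_le_one
    (fun _ _ => pseudoHyp_nonneg _ _) fun ν hν => ?_)).trans (hC a haD)
  exact pseudoHyp_le_one (hlt a haD) (norm_lt_one_of_image hμ ν hν)

theorem IsTsuji.worstCaseError_le (hp : 0 < p) (hm : 0 < m) (hDc : IsCompact D)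
    (hDn : IsConnected D) (hD : D ⊆ Metric.ball (0 : ℂ) 1) (hR : 0 < Rbar) {C : ℝ}
    (hC : ∀ a ∈ D, (Real.sqrt (1 - ‖a‖ ^ 2))⁻¹ ≤ C) {q : ℕ} (hq : q ≠ 0) {η : Fin q → ℂ}
    (hη : IsTsuji D η) :
    worstCaseError p m D Rbar η ≤ Rbar * C * ((q + 1) * minMax D q) := by
  have hlt : ∀ b ∈ D, ‖b‖ < 1 := fun b hb => by simpa using hD hb
  obtain ⟨a, haD, -, hE, -⟩ := exists_isGreatest_optimalError hp hm hDc hDn.nonempty hD hR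
    fun k => hlt _ (hη.1 k)
  rw [hE, mul_assoc]
  refine mul_le_mul_of_nonneg_left ?_ hR.le
  have hC0 : 0 ≤ C := le_trans (by positivity) (hC a haD)
  rcases D.subsingleton_or_nontrivial with hs | hn
  -- On a one-point set the Tsuji points all equal the only possible pole, so the error is zero.
  · obtain rfl := hs.eq_singleton_of_mem haD
    have : resNorm (Finset.univ.image η) a = 0 := by
      refine mul_eq_zero_of_right _ (Finset.prod_eq_zero (i := a) ?_ (pseudoHyp_self a))
      exact Finset.mem_image.mpr ⟨⟨0, Nat.pos_of_ne_zero hq⟩, Finset.mem_univ _, hη.1 _⟩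
    rw [this, minMax_eq_zero hq]
    simp
  · have hinf := hDn.isPreconnected.infinite_of_nontrivial hn
    rw [resNorm_image (hη.injective hlt hinf)]
    exact mul_le_mul (hC a haD) (hη.hypProd_le_minMax hDn.nonempty hlt hinf haD)
      (hypProd_nonneg _ _) hC0

end Bounds

end OBF

theorem mainTheorem1 (p m : ℕ) (hp : 0 < p) (hm : 0 < m)
    (D : Set ℂ) (hDcompact : IsCompact D) (hDconn : IsConnected D)
    (hDdisk : D ⊆ Metric.ball (0 : ℂ) 1) (Rbar : ℝ) (hR : 0 < Rbar) :
    -- the limit that defines `τ(D)` exists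
    Tendsto (OBF.finiteChebyshev D) atTop (𝓝 (OBF.chebyshev D)) ∧
    -- the minimum over the coefficients and the maximum over the systems are attained
    (∀ (q : ℕ) (μ : Fin q → ℂ), (∀ k, μ k ∈ Metric.ball (0 : ℂ) 1) →
      (∀ G ∈ OBF.systemClass p m D Rbar,
        IsLeast
          (Set.range fun R : Fin q → Matrix (Fin p) (Fin m) ℂ =>
            OBF.h2Norm (G - OBF.partialFraction μ R))
          (OBF.optimalError μ G)) ∧
      IsGreatest (OBF.optimalError μ '' OBF.systemClass p m D Rbar)
        (OBF.worstCaseError p m D Rbar μ)) ∧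
    -- the lower bound, for every choice of poles in the unit disk
    (∀ μ : (q : ℕ) → Fin q → ℂ, (∀ q k, μ q k ∈ Metric.ball (0 : ℂ) 1) →
      OBF.chebyshev D ≤
        liminf (fun q : ℕ => OBF.worstCaseError p m D Rbar (μ q) ^ (1 / (q : ℝ))) atTop) ∧
    -- the limit for the Tsuji points
    (∀ η : (q : ℕ) → Fin q → ℂ, (∀ q, OBF.IsTsuji D (η q)) →
      Tendsto (fun q : ℕ => OBF.worstCaseError p m D Rbar (η q) ^ (1 / (q : ℝ))) atTop
        (𝓝 (OBF.chebyshev D))) := by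
  have hlt : ∀ b ∈ D, ‖b‖ < 1 := fun b hb => by simpa using hDdisk hb
  have hne := hDconn.nonempty
  obtain ⟨C, hC0, hC⟩ := OBF.exists_inv_sqrt_le hDcompact hne hDdisk
  obtain ⟨τ, hτ⟩ := OBF.exists_tendsto_rpow_of_submultiplicative (OBF.minMax_nonneg D)
    (OBF.minMax_le_one hlt hne) (OBF.minMax_add_le hlt hne)
  have hfin : Tendsto (OBF.finiteChebyshev D) atTop (𝓝 τ) := hτ.congr' (by
    filter_upwards [eventually_ne_atTop 0] with q hq
    rw [OBF.finiteChebyshev_eq hne hq])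
  have hcheb : OBF.chebyshev D = τ := hfin.limUnder_eq
  rw [hcheb]
  have hlow : Tendsto (fun q : ℕ => (Rbar * (OBF.minMax D q / (q + 1))) ^ (1 / (q : ℝ))) atTop
      (𝓝 τ) := by
    have h := (OBF.tendsto_rpow_one_div_const hR).mul
      (hτ.div OBF.tendsto_rpow_one_div_add_one one_ne_zero)
    rw [div_one, one_mul] at h
    refine h.congr fun q => ?_
    have hq : (0 : ℝ) ≤ q + 1 := by positivity
    rw [Real.mul_rpow hR.le (div_nonneg (OBF.minMax_nonneg D q) hq),
      Real.div_rpow (OBF.minMax_nonneg D q) hq]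
    rfl
  have hup : Tendsto (fun q : ℕ => (Rbar * C * ((q + 1) * OBF.minMax D q)) ^ (1 / (q : ℝ))) atTop
      (𝓝 τ) := by
    have h := (OBF.tendsto_rpow_one_div_const (mul_pos hR hC0)).mul
      (OBF.tendsto_rpow_one_div_add_one.mul hτ)
    rw [one_mul, one_mul] at h
    refine h.congr fun q => ?_
    have hq : (0 : ℝ) ≤ q + 1 := by positivity
    rw [Real.mul_rpow (mul_pos hR hC0).le (mul_nonneg hq (OBF.minMax_nonneg D q)),
      Real.mul_rpow hq (OBF.minMax_nonneg D q)]
  have hle : ∀ μ : (q : ℕ) → Fin q → ℂ, (∀ q k, ‖μ q k‖ < 1) → ∀ᶠ q : ℕ in atTop,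
      (Rbar * (OBF.minMax D q / (q + 1))) ^ (1 / (q : ℝ)) ≤
        OBF.worstCaseError p m D Rbar (μ q) ^ (1 / (q : ℝ)) := fun μ hμ => by
    filter_upwards [eventually_ne_atTop 0] with q hq
    exact Real.rpow_le_rpow
      (mul_nonneg hR.le (div_nonneg (OBF.minMax_nonneg D q) (by positivity)))
      (OBF.le_worstCaseError hp hm hDcompact hDconn hDdisk hR hq (hμ q)) (by positivity)
  refine ⟨hfin, fun q μ hμ => ?_, fun μ hμ => ?_, fun η hη => ?_⟩
  · have hμ' : ∀ k, ‖μ k‖ < 1 := fun k => by simpa using hμ k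
    constructor
    · rintro _ ⟨n, lam, R, -, hlam, -, rfl⟩
      exact OBF.isLeast_range_h2Norm (fun j => hlt _ (hlam j)) hμ' R
    · obtain ⟨a, -, -, -, h⟩ := OBF.exists_isGreatest_optimalError hp hm hDcompact hne hDdisk hR hμ'
      exact h
  · have hμ' : ∀ q k, ‖μ q k‖ < 1 := fun q k => by simpa using hμ q k
    rw [← hlow.liminf_eq]
    refine liminf_le_liminf (hle μ hμ') hlow.isBoundedUnder_ge ?_
    -- Comparing liminfs in ℝ requires coboundedness; the crude bound supplies it, since its q-th
    -- roots converge.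
    have hbound : Tendsto (fun q : ℕ => (Rbar * C) ^ (1 / (q : ℝ))) atTop (𝓝 1) :=
      OBF.tendsto_rpow_one_div_const (mul_pos hR hC0)
    refine (hbound.isBoundedUnder_le.mono_le (Eventually.of_forall fun q => ?_)).isCoboundedUnder_ge
    obtain ⟨h0, h1⟩ := OBF.worstCaseError_le hp hm hDcompact hne hDdisk hR hC (hμ' q)
    exact Real.rpow_le_rpow h0 h1 (by positivity)
  · have hη' : ∀ q k, ‖η q k‖ < 1 := fun q k => hlt _ ((hη q).1 k)
    refine tendsto_of_tendsto_of_tendsto_of_le_of_le' hlow hup (hle η hη') ?_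
    filter_upwards [eventually_ne_atTop 0] with q hq
    exact Real.rpow_le_rpow
      (OBF.worstCaseError_le hp hm hDcompact hne hDdisk hR hC (hη' q)).1
      ((hη q).worstCaseError_le hp hm hDcompact hDconn hDdisk hR hC hq) (by positivity)
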